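/- All graphs are finite and simple. For graphs $G_1,G_2$, the Ramsey number $R(G_1,G_2)$ is the least integer $r$ such that for every graph $G$ on $r$ vertices, either $G$ contains $G_1$ as a (not necessarily induced) subgraph or the complement $\overline{G}$ contains $G_2$ as a (not necessarily induced) subgraph. Let $P_n$ be the path on $n$ vertices. A linear forest is a forest each component of which is a path, and $K_1\vee F$ is the graph obtained from $F$ by adding one new vertex adjacent to every vertex of $F$. Let $n\ge 2$ and $n+1\le m\le 2n-1$, and let $F$ be a linear forest on $m$ vertices such that each component of $F$ has even order. Then $$R(P_n,K_1\vee F)=m+n-2.$$ -/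

import Mathlib

namespace SimpleGraph

/-- The join `G ∨ H`: the disjoint union of `G` and `H` together with all edges between them. -/
def join {V W : Type*} (G : SimpleGraph V) (H : SimpleGraph W) : SimpleGraph (V ⊕ W) :=
  (G ⊕g H) ⊔ completeBipartiteGraph V W

/-- A linear forest: a forest each component of which is a path. -/
def IsLinearForest {V : Type*} (F : SimpleGraph V) : Prop :=
  F.IsAcyclic ∧
    ∀ c : F.ConnectedComponent, ∃ k : ℕ, Nonempty (c.toSimpleGraph ≃g pathGraph k)

/-- `r` is the Ramsey number `R(G₁, G₂)`: the least `r` such that for every graph `G` on `r`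
vertices, either `G` contains `G₁` or the complement of `G` contains `G₂`
(as a not necessarily induced subgraph). -/
def IsRamseyNumber {V₁ V₂ : Type*} (G₁ : SimpleGraph V₁) (G₂ : SimpleGraph V₂) (r : ℕ) : Prop :=
  IsLeast {r : ℕ | ∀ G : SimpleGraph (Fin r), G₁.IsContained G ∨ G₂.IsContained Gᶜ} r

end SimpleGraph

/-! Evenness is used twice: `m = 2 * k`, and `F` has a perfect matching, so its independent sets
have at most `k` vertices.

Lower bound: disjoint cliques of orders `n - 1`, `k - 1`, `k - 1` contain no `P_n`, as `k ≤ n`. The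
complement is complete tripartite; the hub blocks one class, and the other two hold at most `k + (k
- 1)` vertices of `F`.

Upper bound: a linear forest lies in the path of the same order, so a `P_n`-free `G` needs only a
vertex whose non-neighbors carry a path of `Gᶜ` on `2 * k` vertices (`exists_hub`). If all
components have fewer than `n` vertices, any vertex of a smallest one works. Otherwise crossing
chords on a longest path yield `v` with `2 * deg v + 2 ≤ n`, and the Gerencsér–Gyárfás bound
(`IsLongestPathList.card_lt`) applies to the non-neighbors of `v`, unless `n = 2 * deg v + 2`, when
they are one too few. Then either the path exists anyway or a longest path of `Gᶜ` there has `2 * k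
- 1` vertices, and one of its ends is the hub.

The engine: a vertex off a longest path `Q` of `Gᶜ` is `G`-adjacent to both ends of `Q` and to one
of any two consecutive vertices, so `G` has long paths alternating between `Q` and the vertices it
misses. -/

namespace SimpleGraph

/-- `l` lists the vertices of a path of `G` all of whose vertices lie in `W`. -/
structure IsPathList {α : Type*} (G : SimpleGraph α) (W : Set α) (l : List α) : Prop where
  nodup : l.Nodup
  chain : l.IsChain G.Adj
  mem : ∀ x ∈ l, x ∈ W

/-- `l` lists the vertices of a longest path of `G` inside `W`. -/
structure IsLongestPathList {α : Type*} (G : SimpleGraph α) (W : Set α) (l : List α) : Prop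
    extends G.IsPathList W l where
  le : ∀ l', G.IsPathList W l' → l'.length ≤ l.length

/-! ### Paths as lists of vertices -/

section PathLists

variable {α : Type*} {G H : SimpleGraph α} {W : Set α} {l : List α}

theorem isChain_adj_reverse (h : l.IsChain G.Adj) : l.reverse.IsChain G.Adj :=
  List.isChain_reverse.2 (h.imp fun _ _ hab => hab.symm)

theorem IsPathList.reverse (h : G.IsPathList W l) : G.IsPathList W l.reverse :=
  ⟨List.nodup_reverse.2 h.nodup, isChain_adj_reverse h.chain, by simpa using h.mem⟩

theorem IsPathList.infix {l' : List α} (h : G.IsPathList W l) (hl : l' <:+: l) :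
    G.IsPathList W l' :=
  ⟨hl.sublist.nodup h.nodup, h.chain.infix hl, fun x hx => h.mem x (hl.subset hx)⟩

theorem IsPathList.mono {W' : Set α} (h : G.IsPathList W l) (hW : W ⊆ W') : G.IsPathList W' l :=
  ⟨h.nodup, h.chain, fun x hx => hW (h.mem x hx)⟩

theorem IsLongestPathList.reverse (h : G.IsLongestPathList W l) :
    G.IsLongestPathList W l.reverse :=
  ⟨h.toIsPathList.reverse, by simpa using h.le⟩

theorem exists_isLongestPathList [Finite α] (G : SimpleGraph α) (W : Set α) :
    ∃ l, G.IsLongestPathList W l := by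
  classical
  have := Fintype.ofFinite α
  have hfin : Finite {l : List α // G.IsPathList W l} :=
    Finite.of_injective (β := {l : List α // l.Nodup}) (fun l => ⟨l.1, l.2.nodup⟩)
      fun a b hab => Subtype.ext (by simpa using hab)
  have hne : Nonempty {l : List α // G.IsPathList W l} := ⟨[], by simp, by simp, by simp⟩
  obtain ⟨l, hl⟩ := Finite.exists_max fun l : {l : List α // G.IsPathList W l} => l.1.length
  exact ⟨l.1, l.2, fun l' h' => hl ⟨l', h'⟩⟩

theorem IsPathList.isContained (h : G.IsPathList W l) :
    (pathGraph l.length).IsContained G := by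
  refine ⟨⟨⟨fun i => l[i], ?_⟩, fun i j hij => ?_⟩⟩
  · intro i j hij
    rw [pathGraph_adj] at hij
    have hc := List.isChain_iff_getElem.1 h.chain
    obtain ⟨i, hi⟩ := i
    obtain ⟨j, hj⟩ := j
    simp only at hij
    rcases hij with rfl | rfl
    · exact hc i hj
    · exact (hc j hi).symm
  · exact Fin.ext ((List.Nodup.getElem_inj_iff h.nodup).1 hij)

theorem exists_isPathList_of_isContained {n : ℕ} (h : (pathGraph n).IsContained G) :
    ∃ l, G.IsPathList Set.univ l ∧ l.length = n := by
  obtain ⟨f⟩ := h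
  refine ⟨(List.finRange n).map f, ⟨(List.nodup_finRange n).map f.injective, ?_, by simp⟩, by simp⟩
  rw [List.isChain_iff_getElem]
  intro i hi
  simp only [List.getElem_map, List.getElem_finRange]
  exact f.toHom.map_adj (pathGraph_adj.2 (Or.inl (by simp)))

theorem IsPathList.length_lt {n : ℕ} (hG : ¬ (pathGraph n).IsContained G)
    (h : G.IsPathList W l) : l.length < n := by
  by_contra! hn
  apply hG
  have h' := (h.infix (List.take_prefix n l).isInfix).isContained
  rwa [List.length_take, min_eq_left hn] at h'

end PathLists

end SimpleGraph

/-! ### Neighbors of a vertex off a longest path -/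

theorem List.IsChain.length_le_two_mul_countP {α : Type*} (p : α → Bool) :
    ∀ {l : List α}, l.IsChain (fun a b => p a ∨ p b) → (∀ x ∈ l.getLast?, p x) →
      l.length ≤ 2 * l.countP p ∧
        (l ≠ [] → (∀ x ∈ l.head?, p x) → l.length + 1 ≤ 2 * l.countP p)
  | [], _, _ => by simp
  | [a], _, hl => by simp_all
  | a :: b :: t, hc, hl => by
    rw [List.isChain_cons_cons] at hc
    obtain ⟨h₁, h₂⟩ := hc.2.length_le_two_mul_countP p (by simpa using hl)
    have h₂ : p b = true → _ := fun hb => h₂ (by simp) (by simpa using hb)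
    simp only [List.countP_cons, List.length_cons] at h₁ h₂ ⊢
    by_cases ha : p a
    · simp only [ha, if_true]
      simp
      omega
    · have hb := h₂ (hc.1.resolve_left ha)
      simp [ha]
      omega

namespace SimpleGraph

section Longest

variable {α : Type*} {G H : SimpleGraph α} {W : Set α} {Q : List α}

/-- Otherwise `s` could be prepended to `Q`. -/
theorem IsLongestPathList.adj_head (hGH : ∀ x y, x ≠ y → G.Adj x y ∨ H.Adj x y)
    (hQ : H.IsLongestPathList W Q) {s : α} (hs : s ∈ W) (hsQ : s ∉ Q) :
    ∀ x ∈ Q.head?, G.Adj s x := by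
  intro x hx
  have hxQ : x ∈ Q := List.mem_of_mem_head? hx
  by_contra hn
  have hH := (hGH s x (by rintro rfl; exact hsQ hxQ)).resolve_left hn
  have := hQ.le (s :: Q) ⟨List.nodup_cons.2 ⟨hsQ, hQ.nodup⟩, hQ.chain.cons (by
    intro y hy; rw [Option.mem_unique hy hx]; exact hH), by simpa [hs] using hQ.mem⟩
  simp at this

theorem IsLongestPathList.adj_getLast (hGH : ∀ x y, x ≠ y → G.Adj x y ∨ H.Adj x y)
    (hQ : H.IsLongestPathList W Q) {s : α} (hs : s ∈ W) (hsQ : s ∉ Q) :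
    ∀ x ∈ Q.getLast?, G.Adj s x := by
  intro x hx
  exact hQ.reverse.adj_head hGH hs (by simpa using hsQ) x (by simpa using hx)

/-- Otherwise `s` could be inserted between `a` and `b`. -/
theorem IsLongestPathList.isChain_adj_or (hGH : ∀ x y, x ≠ y → G.Adj x y ∨ H.Adj x y)
    (hQ : H.IsLongestPathList W Q) {s : α} (hs : s ∈ W) (hsQ : s ∉ Q) :
    Q.IsChain (fun a b => G.Adj s a ∨ G.Adj s b) := by
  rw [List.isChain_iff_forall_rel_of_append_cons_cons]
  rintro a b l₁ l₂ rfl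
  by_contra! hn
  have ha := (hGH s a (by rintro rfl; simp at hsQ)).resolve_left hn.1
  have hb := (hGH s b (by rintro rfl; simp at hsQ)).resolve_left hn.2
  have hc := List.isChain_append_cons_cons.1 hQ.chain
  have := hQ.le (l₁ ++ a :: s :: b :: l₂) ⟨?_, ?_, ?_⟩
  · simp at this
  · have := hQ.nodup
    grind
  · exact List.isChain_append_cons_cons.2 ⟨hc.1, ha.symm, List.isChain_cons_cons.2 ⟨hb, hc.2.2⟩⟩
  · have := hQ.mem
    grind

theorem IsLongestPathList.length_lt_two_mul_countP [DecidableRel G.Adj]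
    (hGH : ∀ x y, x ≠ y → G.Adj x y ∨ H.Adj x y)
    (hQ : H.IsLongestPathList W Q) {s : α} (hs : s ∈ W) (hsQ : s ∉ Q) :
    Q.length + 1 ≤ 2 * Q.countP (fun x => G.Adj s x) := by
  refine (List.IsChain.length_le_two_mul_countP (fun x => decide (G.Adj s x)) (l := Q) ?_ ?_).2
    ?_ ?_
  · simpa using hQ.isChain_adj_or hGH hs hsQ
  · simpa using hQ.adj_getLast hGH hs hsQ
  · rintro rfl
    have := hQ.le [s] ⟨by simp, by simp, by simpa using hs⟩
    simp at this
  · simpa using hQ.adj_head hGH hs hsQ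

end Longest

/-! ### Alternating paths and the Gerencsér–Gyárfás bound -/

/-- Two disjoint paths that together visit all of `l` and have their ends in `l`, when
every vertex of `l` is adjacent to one of any two consecutive vertices of `M`. -/
theorem exists_two_paths {α : Type*} (B : SimpleGraph α) : ∀ l M : List α, 2 ≤ l.length →
    2 * l.length ≤ M.length + 4 → (l ++ M).Nodup →
    (∀ s ∈ l, M.IsChain (fun a b => B.Adj s a ∨ B.Adj s b)) →
    ∃ (a : α) (A : List α) (c : α) (C : List α), ((a :: A) ++ (c :: C)).Nodup ∧
      (a :: A).IsChain B.Adj ∧ (c :: C).IsChain B.Adj ∧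
      (∀ x ∈ (a :: A) ++ (c :: C), x ∈ l ++ M) ∧ (∀ x ∈ l, x ∈ (a :: A) ++ (c :: C)) ∧
      A.length + C.length + 4 = 2 * l.length ∧ a ∈ l ∧ c ∈ l ∧
      (∀ x ∈ (a :: A).getLast?, x ∈ l) ∧ (∀ x ∈ (c :: C).getLast?, x ∈ l)
  | [], _ => by simp
  | [s], _ => by simp
  | [s, t], M => by
    intro _ _ hd _
    exact ⟨s, [], t, [], by simp_all, by simp, by simp, by simp, by simp, by simp,
      by simp, by simp, by simp, by simp⟩
  | s :: t :: u :: l, [] => by simp; omega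
  | s :: t :: u :: l, [_] => by simp; omega
  | s :: t :: u :: l, p :: q :: M => by
    intro _ hlen hd hadj
    generalize hl : t :: u :: l = l' at *
    obtain ⟨a, A, c, C, hnd, hA, hC, hsub, hsup, hlen', ha, hc, hA', hC'⟩ :=
      exists_two_paths B l' M (by simp [← hl]) (by simp at hlen ⊢; omega) (by grind)
        fun s hs => (hadj s (by simp [hs])).tail.tail
    have hadj' : ∀ x ∈ s :: l', B.Adj x p ∨ B.Adj x q := fun x hx =>
      (List.isChain_cons_cons.1 (hadj x hx)).1
    -- Pigeonhole: two of `s`, `a`, `c` share a neighbor in `{p, q}`, and it links them. Each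
    -- induction step thus consumes two vertices of `M` and uses one.
    have key : ∃ r, (r = p ∨ r = q) ∧ ((B.Adj s r ∧ B.Adj a r) ∨ (B.Adj s r ∧ B.Adj c r) ∨
        (B.Adj a r ∧ B.Adj c r)) := by
      have h₁ := hadj' s (by simp)
      have h₂ := hadj' a (by simp [ha])
      have h₃ := hadj' c (by simp [hc])
      clear * - h₁ h₂ h₃
      rcases h₁ with h₁ | h₁ <;> rcases h₂ with h₂ | h₂ <;> rcases h₃ with h₃ | h₃ <;>
        first
        | exact ⟨p, Or.inl rfl, Or.inl ⟨‹_›, ‹_›⟩⟩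
        | exact ⟨q, Or.inr rfl, Or.inl ⟨‹_›, ‹_›⟩⟩
        | exact ⟨p, Or.inl rfl, Or.inr (Or.inl ⟨‹_›, ‹_›⟩)⟩
        | exact ⟨q, Or.inr rfl, Or.inr (Or.inl ⟨‹_›, ‹_›⟩)⟩
        | exact ⟨p, Or.inl rfl, Or.inr (Or.inr ⟨‹_›, ‹_›⟩)⟩
        | exact ⟨q, Or.inr rfl, Or.inr (Or.inr ⟨‹_›, ‹_›⟩)⟩
    obtain ⟨r, hr, h⟩ := key
    have hrM : r ∈ p :: q :: M := by rcases hr with rfl | rfl <;> simp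
    have hdM : r ∉ M := by
      have := (List.nodup_append.1 hd).2.1
      rcases hr with rfl | rfl <;> grind
    have hdl : s ∉ l' ++ (p :: q :: M) := (List.nodup_cons.1 hd).1
    have hrl : r ∉ l' := fun hr' =>
      (List.nodup_append.1 (List.nodup_cons.1 hd).2).2.2 r hr' r hrM rfl
    have hsub' : ∀ x ∈ l' ++ M, x ∈ l' ++ (p :: q :: M) := fun x hx => by
      simp only [List.mem_append, List.mem_cons] at hx ⊢
      exact hx.imp_right fun h => Or.inr (Or.inr h)
    have hperm : ∀ L : List α, L.Perm (s :: r :: ((a :: A) ++ (c :: C))) → L.Nodup ∧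
        (∀ x ∈ L, x ∈ (s :: l') ++ (p :: q :: M)) ∧ (∀ x ∈ s :: l', x ∈ L) := by
      intro L hL
      refine ⟨hL.nodup_iff.2 (List.nodup_cons.2 ⟨?_, List.nodup_cons.2 ⟨?_, hnd⟩⟩), ?_, ?_⟩
      · rw [List.mem_cons, not_or]
        refine ⟨?_, fun h => hdl (hsub' s (hsub s h))⟩
        rintro rfl
        exact hdl (List.mem_append_right _ hrM)
      · intro h
        rcases List.mem_append.1 (hsub r h) with h | h
        exacts [hrl h, hdM h]
      · intro x hx
        rw [hL.mem_iff, List.mem_cons, List.mem_cons] at hx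
        rw [List.cons_append, List.mem_cons]
        rcases hx with rfl | rfl | hx
        exacts [Or.inl rfl, Or.inr (List.mem_append_right _ hrM), Or.inr (hsub' x (hsub x hx))]
      · intro x hx
        rw [hL.mem_iff, List.mem_cons, List.mem_cons]
        exact (List.mem_cons.1 hx).imp_right fun h => Or.inr (hsup x h)
    rcases h with h | h | h
    · obtain ⟨h₁, h₂, h₃⟩ := hperm ((s :: r :: a :: A) ++ (c :: C)) (by simp)
      refine ⟨s, r :: a :: A, c, C, h₁, ?_, hC, h₂, h₃, ?_, by simp, by simp [hc], ?_, ?_⟩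
      · simp [h, hA, h.2.symm]
      · simp; omega
      · intro x hx; simp at hx hA'; simp [hA' x hx]
      · intro x hx; simp [hC' x hx]
    · obtain ⟨h₁, h₂, h₃⟩ := hperm ((a :: A) ++ (s :: r :: c :: C))
        (List.perm_append_comm.trans
          ((List.perm_append_comm (l₁ := c :: C) (l₂ := a :: A)).cons r |>.cons s))
      refine ⟨a, A, s, r :: c :: C, h₁, hA, ?_, h₂, h₃, ?_, by simp [ha], by simp, ?_, ?_⟩
      · simp [h, hC, h.2.symm]
      · simp; omega
      · intro x hx; simp [hA' x hx]
      · intro x hx; simp at hx hC'; simp [hC' x hx]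
    -- The two old paths merge through `r`, and `s` alone becomes the second path.
    · obtain ⟨e, E, hE⟩ : ∃ e E, (a :: A).reverse = e :: E :=
        List.exists_cons_of_ne_nil (by simp)
      have he : (a :: A).getLast? = some e := by
        rw [← List.head?_reverse, hE]; rfl
      have hElen : E.length = A.length := by
        have := congrArg List.length hE; simpa using this.symm
      have hEc : ((e :: E) ++ r :: c :: C).IsChain B.Adj := by
        rw [← hE, List.isChain_append]
        refine ⟨isChain_adj_reverse hA, by simp [hC, h.2.symm], ?_⟩
        intro x hx y hy
        simp at hx hy
        subst hx hy
        exact h.1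
      obtain ⟨h₁, h₂, h₃⟩ := hperm ((e :: (E ++ r :: c :: C)) ++ [s]) (by
        refine List.perm_append_comm.trans (List.Perm.cons s ?_)
        change ((e :: E) ++ r :: c :: C).Perm _
        rw [← hE]
        exact List.perm_middle.trans ((List.reverse_perm _).append_right _ |>.cons r))
      refine ⟨e, E ++ r :: c :: C, s, [], h₁, hEc, by simp, h₂, h₃, ?_, ?_, by simp, ?_, ?_⟩
      · simp; omega
      · simp [hA' e he]
      · intro x hx
        have : x ∈ (c :: C).getLast? := by
          simpa [List.getLast?_cons, List.getLast?_append] using hx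
        simp [hC' x this]
      · simp

section Alternating

variable {α : Type*} {G H : SimpleGraph α} {W : Set α} {Q T : List α}

/-- `T` and the more than `Q.length / 2` neighbors of `s` on `Q` are disjoint, so together they do
not fit in `L`. -/
theorem IsLongestPathList.exists_adj_notMem (hGH : ∀ x y, x ≠ y → G.Adj x y ∨ H.Adj x y)
    (hQ : H.IsLongestPathList W Q) (hT : T.Nodup) (hTQ : ∀ s ∈ T, s ∉ Q) {s : α} (hs : s ∈ W)
    (hsQ : s ∉ Q) {L : List α} (hTL : T ⊆ L)
    (hlen : 2 * L.length < 2 * T.length + Q.length + 1) :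
    ∃ c ∈ Q, G.Adj s c ∧ c ∉ L := by
  classical
  by_contra! hn
  have hcount := hQ.length_lt_two_mul_countP hGH hs hsQ
  rw [List.countP_eq_length_filter] at hcount
  have hnd : (T ++ Q.filter fun x => G.Adj s x).Nodup := by
    refine List.nodup_append.2 ⟨hT, hQ.nodup.filter _, ?_⟩
    rintro a ha b hb rfl
    exact hTQ a ha (List.mem_of_mem_filter hb)
  have hsub : (T ++ Q.filter fun x => G.Adj s x) ⊆ L := by
    intro x hx
    rcases List.mem_append.1 hx with h | h
    · exact hTL h
    · rw [List.mem_filter] at h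
      exact hn x h.1 (by simpa using h.2)
  have := (List.subperm_of_subset hnd hsub).length_le
  simp only [List.length_append] at this
  omega

/-- A path that alternates between the vertices of `T` and the vertices of a longest path `Q`
of the other graph, starting and ending in `T` and avoiding the last vertex of `Q`. -/
theorem IsLongestPathList.exists_alternating_cover
    (hGH : ∀ x y, x ≠ y → G.Adj x y ∨ H.Adj x y)
    (hQ : H.IsLongestPathList W Q) (hT : T.Nodup) (hTW : ∀ s ∈ T, s ∈ W)
    (hTQ : ∀ s ∈ T, s ∉ Q) (hT0 : T ≠ []) (hlen : 2 * T.length ≤ Q.length + 2) :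
    ∃ L : List α, L.Nodup ∧ L.IsChain (G.between {x | x ∈ T} {x | x ∈ T}ᶜ).Adj ∧
      (∀ x ∈ L, x ∈ T ∨ x ∈ Q.dropLast) ∧ T ⊆ L ∧ L.length + 1 = 2 * T.length ∧
      (∀ x ∈ L.head?, x ∈ T) ∧ (∀ x ∈ L.getLast?, x ∈ T) := by
  have hB : ∀ s ∈ T, ∀ y ∈ Q, G.Adj s y → (G.between {x | x ∈ T} {x | x ∈ T}ᶜ).Adj s y := by
    intro s hs y hy h
    exact ⟨h, Or.inl ⟨hs, fun hy' => hTQ y hy' hy⟩⟩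
  match T, hT0 with
  | [s], _ => exact ⟨[s], by simp⟩
  | s :: t :: T', _ =>
    generalize hTe : s :: t :: T' = T at *
    have hT2 : 2 ≤ T.length := by simp [← hTe]
    obtain ⟨y, Q', rfl⟩ := List.exists_cons_of_ne_nil (l := Q) (by rintro rfl; simp at hlen; omega)
    rcases List.eq_nil_or_concat' Q' with rfl | ⟨M, z, rfl⟩
    · simp at hlen; omega
    -- Only the interior `M` of `Q` is used here: `y`, adjacent to all of `T`, joins the two paths,
    -- and `z` stays free to extend the result.
    obtain ⟨a, A, c, C, hnd, hA, hC, hsub, hsup, hlen', ha, hc, hA', hC'⟩ :=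
      exists_two_paths (G.between {x | x ∈ T} {x | x ∈ T}ᶜ) T M hT2
        (by simp at hlen; omega)
        (List.nodup_append.2 ⟨hT, by have := hQ.nodup; grind, by grind⟩)
        (by
          intro x hx
          have := (hQ.isChain_adj_or hGH (hTW x hx) (hTQ x hx)).infix (l₁ := M) ⟨[y], [z], by simp⟩
          refine this.imp_of_mem_imp fun u v hu hv => Or.imp ?_ ?_
          · exact hB x hx u (by simp [hu])
          · exact hB x hx v (by simp [hv]))
    have hy : ∀ x ∈ T, (G.between {x | x ∈ T} {x | x ∈ T}ᶜ).Adj x y := fun x hx =>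
      hB x hx y (by simp) (hQ.adj_head hGH (hTW x hx) (hTQ x hx) y (by simp))
    have hyM : y ∉ (a :: A) ++ (c :: C) := by
      intro h
      rcases List.mem_append.1 (hsub y h) with h | h
      · exact hTQ y h (by simp)
      · have := hQ.nodup
        simp [h] at this
    have hp : ((a :: A).reverse ++ y :: c :: C).Perm (y :: ((a :: A) ++ (c :: C))) :=
      List.perm_middle.trans ((List.reverse_perm _).append_right _ |>.cons y)
    refine ⟨(a :: A).reverse ++ y :: c :: C, ?_, ?_, ?_, ?_, ?_, ?_, ?_⟩
    · exact hp.nodup_iff.2 (List.nodup_cons.2 ⟨hyM, hnd⟩)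
    · refine List.isChain_append.2 ⟨isChain_adj_reverse hA,
        List.isChain_cons_cons.2 ⟨(hy c hc).symm, hC⟩, ?_⟩
      intro u hu v hv
      simp at hu hv
      subst hu hv
      exact hy _ ha
    · intro x hx
      rw [hp.mem_iff, List.mem_cons] at hx
      rcases hx with rfl | hx
      · simp [List.dropLast_cons_of_ne_nil]
      · rcases List.mem_append.1 (hsub x hx) with h | h
        · exact Or.inl h
        · right
          rw [← List.cons_append, List.dropLast_concat]
          simp [h]
    · intro x hx
      rw [hp.mem_iff]
      exact List.mem_cons_of_mem _ (hsup x hx)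
    · simp only [List.length_append, List.length_reverse, List.length_cons]
      omega
    · intro x hx
      refine hA' x ?_
      simpa [List.head?_append, List.getLast?_cons] using hx
    · intro x hx
      refine hC' x ?_
      simpa [List.getLast?_append, List.getLast?_cons] using hx

theorem IsLongestPathList.exists_even_path (hGH : ∀ x y, x ≠ y → G.Adj x y ∨ H.Adj x y)
    (hQ : H.IsLongestPathList W Q) (hT : T.Nodup) (hTW : ∀ s ∈ T, s ∈ W)
    (hTQ : ∀ s ∈ T, s ∉ Q) (hT0 : T ≠ []) (hlen : 2 * T.length ≤ Q.length + 2) {z : α}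
    (hz : z ∈ Q.getLast?) :
    ∃ L : List α, (G.between {x | x ∈ T} {x | x ∈ T}ᶜ).IsPathList W (z :: L) ∧
      T ⊆ L ∧ L.length + 1 = 2 * T.length ∧ (∀ x ∈ L.getLast?, x ∈ T) := by
  obtain ⟨L, hnd, hch, hsub, hTL, hL, hhead, hlast⟩ :=
    hQ.exists_alternating_cover hGH hT hTW hTQ hT0 hlen
  have hzQ : z ∈ Q := List.mem_of_mem_getLast? hz
  refine ⟨L, ⟨List.nodup_cons.2 ⟨fun h => ?_, hnd⟩, hch.cons fun y hy => ?_, ?_⟩, hTL, hL, hlast⟩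
  · rcases hsub z h with h | h
    · exact hTQ z h hzQ
    · obtain ⟨Q', rfl⟩ : ∃ Q', Q = Q' ++ [z] := by
        rcases List.eq_nil_or_concat' Q with rfl | ⟨Q', y, rfl⟩
        · simp at hz
        · simp at hz; exact ⟨Q', by rw [hz]⟩
      have := hQ.nodup
      rw [List.dropLast_concat] at h
      rw [List.nodup_append] at this
      exact this.2.2 z h z (by simp) rfl
  · have hyT := hhead y hy
    exact ⟨(hQ.adj_getLast hGH (hTW y hyT) (hTQ y hyT) z hz).symm,
      Or.inr ⟨fun h => hTQ z h hzQ, hyT⟩⟩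
  · intro x hx
    rcases List.mem_cons.1 hx with rfl | hx
    · exact hQ.mem _ hzQ
    · rcases hsub x hx with h | h
      exacts [hTW x h, hQ.mem x (List.dropLast_subset _ h)]

theorem IsLongestPathList.exists_odd_path (hGH : ∀ x y, x ≠ y → G.Adj x y ∨ H.Adj x y)
    (hQ : H.IsLongestPathList W Q) (hT : T.Nodup) (hTW : ∀ s ∈ T, s ∈ W)
    (hTQ : ∀ s ∈ T, s ∉ Q) (hT0 : T ≠ []) (hlen : 2 * T.length ≤ Q.length) {z : α}
    (hz : z ∈ Q.getLast?) :
    ∃ L : List α, (G.between {x | x ∈ T} {x | x ∈ T}ᶜ).IsPathList W (z :: L) ∧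
      T ⊆ L ∧ L.length = 2 * T.length := by
  obtain ⟨L, hL, hTL, hlenL, hlast⟩ := hQ.exists_even_path hGH hT hTW hTQ hT0 (by omega) hz
  obtain ⟨L', e, rfl⟩ : ∃ L' e, L = L' ++ [e] :=
    (List.eq_nil_or_concat' L).resolve_left (by
      rintro rfl
      exact hT0 (List.subset_nil.1 hTL))
  have he : e ∈ T := hlast e (by simp)
  -- The path has used `T.length ≤ Q.length / 2` vertices of `Q`, fewer than `e` has neighbors
  -- there.
  obtain ⟨c, hcQ, hec, hcL⟩ := hQ.exists_adj_notMem hGH hT hTQ (hTW e he) (hTQ e he)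
    (L := z :: (L' ++ [e])) (fun x hx => List.mem_cons_of_mem _ (hTL hx))
    (by rw [List.length_cons]; omega)
  refine ⟨L' ++ [e] ++ [c], ⟨?_, ?_, ?_⟩, fun x hx => List.mem_append_left _ (hTL hx), ?_⟩
  · rw [← List.cons_append, List.nodup_append]
    refine ⟨hL.nodup, by simp, ?_⟩
    rintro a ha b hb rfl
    rw [List.mem_singleton] at hb
    exact hcL (hb ▸ ha)
  · rw [← List.cons_append, List.isChain_append]
    refine ⟨hL.chain, by simp, ?_⟩
    intro x hx y hy
    simp [List.getLast?_cons] at hx hy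
    subst hx hy
    exact ⟨hec, Or.inl ⟨he, fun h => hTQ _ h hcQ⟩⟩
  · intro x hx
    rw [← List.cons_append, List.mem_append, List.mem_singleton] at hx
    rcases hx with hx | rfl
    exacts [hL.mem x hx, hQ.mem _ hcQ]
  · rw [List.length_append, List.length_singleton]
    omega

theorem IsPathList.of_between {S S' : Set α} {l : List α} (h : (G.between S S').IsPathList W l) :
    G.IsPathList W l :=
  ⟨h.nodup, h.chain.imp fun _ _ h => h.1, h.mem⟩

end Alternating

/-- The upper bound of Gerencsér and Gyárfás in terms of the orders of two longest paths. -/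
theorem IsLongestPathList.card_lt {α : Type*} [DecidableEq α] {G H : SimpleGraph α}
    {U : Finset α} {P Q : List α} (hGH : ∀ x y, x ≠ y → G.Adj x y ∨ H.Adj x y)
    (hP : G.IsLongestPathList (U : Set α) P) (hQ : H.IsLongestPathList (U : Set α) Q)
    (hU : U.Nonempty) (hPQ : P.length ≤ Q.length) :
    U.card + 1 ≤ Q.length + (P.length + 1) / 2 := by
  by_contra! hlt
  obtain ⟨u, hu⟩ := hU
  have hP1 : 1 ≤ P.length := hP.le [u] ⟨by simp, by simp, by simpa using hu⟩
  have hcard : (P.length + 1) / 2 ≤ (U \ Q.toFinset).card := by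
    have h₁ := Finset.le_card_sdiff Q.toFinset U
    have h₂ := List.toFinset_card_le Q
    omega
  obtain ⟨S, hS, hScard⟩ := Finset.exists_subset_card_eq hcard
  have hT : S.toList.Nodup := S.nodup_toList
  have hTW : ∀ s ∈ S.toList, s ∈ (U : Set α) := fun s hs =>
    (Finset.mem_sdiff.1 (hS (Finset.mem_toList.1 hs))).1
  have hTQ : ∀ s ∈ S.toList, s ∉ Q := fun s hs h =>
    (Finset.mem_sdiff.1 (hS (Finset.mem_toList.1 hs))).2 (List.mem_toFinset.2 h)
  have hTlen : S.toList.length = (P.length + 1) / 2 := by rw [Finset.length_toList, hScard]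
  have hT0 : S.toList ≠ [] := by
    intro h
    rw [h] at hTlen
    simp at hTlen
    omega
  obtain ⟨z, hz⟩ : ∃ z, z ∈ Q.getLast? := by
    cases h : Q.getLast? with
    | none => rw [List.getLast?_eq_none_iff] at h; rw [h, List.length_nil] at hPQ; omega
    | some z => exact ⟨z, rfl⟩
  -- The missed vertices give an alternating path of `G` with one vertex more than `P`; the parity
  -- of `P.length` decides whether it ends on `Q` or in `T`.
  rcases Nat.even_or_odd' P.length with ⟨k, hk | hk⟩
  · obtain ⟨L, hL, -, hlen⟩ := hQ.exists_odd_path hGH hT hTW hTQ hT0 (by omega) hz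
    have := hP.le _ hL.of_between
    rw [List.length_cons] at this
    omega
  · obtain ⟨L, hL, -, hlen, -⟩ := hQ.exists_even_path hGH hT hTW hTQ hT0 (by omega) hz
    have := hP.le _ hL.of_between
    rw [List.length_cons] at this
    omega

end SimpleGraph

/-! ### A vertex of small degree in a large component -/

/-- Each consecutive pair contributes at most one to the two counts. With `f`, `g` marking the
neighbors of the two ends of a path, it bounds their degree sum when no chords cross. -/
theorem List.IsChain.countP_tail_add_countP_lt {α : Type*} (f g : α → Bool) :
    ∀ {l : List α}, l.IsChain (fun a b => ¬(f b ∧ g a)) → l ≠ [] →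
      (∀ x ∈ l.getLast?, ¬ g x) → l.tail.countP f + l.countP g + 1 ≤ l.length
  | [], _, h, _ => (h rfl).elim
  | [a], _, _, hl => by simp_all
  | a :: b :: t, hc, _, hl => by
    rw [List.isChain_cons_cons] at hc
    have ih := hc.2.countP_tail_add_countP_lt f g (by simp) (by simpa using hl)
    have h := hc.1
    simp only [List.tail_cons, List.countP_cons, List.length_cons] at ih ⊢
    cases hf : f b <;> cases hg : g a <;> simp_all <;> omega

namespace SimpleGraph

section LowDegree

variable {α : Type*} {G : SimpleGraph α} {l : List α}

/-- A cycle can be cut open at any of its vertices. -/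
theorem exists_perm_cons_isChain {c : α} (h : l.IsChain G.Adj)
    (hcl : ∀ x ∈ l.head?, ∀ y ∈ l.getLast?, G.Adj y x) (hc : c ∈ l) :
    ∃ L, (c :: L).Perm l ∧ (c :: L).IsChain G.Adj := by
  obtain ⟨A, B, rfl⟩ := List.append_of_mem hc
  refine ⟨B ++ A, List.perm_append_comm (l₁ := c :: B), ?_⟩
  rw [List.isChain_append] at h
  rw [← List.cons_append, List.isChain_append]
  refine ⟨h.2.1, h.1, fun x hx y hy => hcl y ?_ x ?_⟩
  · rw [List.head?_append, hy]; rfl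
  · rw [List.getLast?_append, hx]; rfl

theorem IsLongestPathList.mem_of_adj_head {D : Set α} (hl : G.IsLongestPathList D l)
    (hD : ∀ x ∈ D, ∀ y, G.Adj x y → y ∈ D) {x w : α} (hx : x ∈ l.head?) (hw : G.Adj x w) :
    w ∈ l := by
  by_contra hn
  have := hl.le (w :: l) ⟨List.nodup_cons.2 ⟨hn, hl.nodup⟩, hl.chain.cons (by
    intro y hy; rw [Option.mem_unique hy hx]; exact hw.symm), by
    intro y hy
    rcases List.mem_cons.1 hy with rfl | hy
    exacts [hD x (hl.mem x (List.mem_of_mem_head? hx)) _ hw, hl.mem y hy]⟩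
  simp at this

open Classical in
theorem degree_le_countP [Fintype α] {x : α} (h : ∀ w, G.Adj x w → w ∈ l) :
    G.degree x ≤ l.countP (fun w => G.Adj x w) := by
  rw [List.countP_eq_length_filter, ← card_neighborFinset_eq_degree]
  refine le_trans (Finset.card_le_card fun w hw => ?_) (List.toFinset_card_le _)
  rw [mem_neighborFinset] at hw
  simp [hw, h w hw]

/-- In a graph without a path on `n` vertices, a component with at least `n` vertices has a vertex
of small degree. -/
theorem exists_two_mul_degree_add_two_le [Fintype α] [DecidableRel G.Adj] {n : ℕ}
    (hG : ¬ (pathGraph n).IsContained G) (a : α)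
    (ha : n ≤ {x | G.Reachable a x}.ncard) : ∃ v, 2 * G.degree v + 2 ≤ n := by
  classical
  set D : Set α := {x | G.Reachable a x} with hDdef
  have hD : ∀ x ∈ D, ∀ y, G.Adj x y → y ∈ D := fun x hx y hxy =>
    Reachable.trans hx hxy.reachable
  obtain ⟨l, hl⟩ := exists_isLongestPathList G D
  have hln : l.length < n := hl.length_lt hG
  have hl1 : 1 ≤ l.length := hl.le [a] ⟨by simp, by simp, by simp [hDdef]⟩
  have hl0 : l ≠ [] := by rintro rfl; simp at hl1
  obtain ⟨x, hx⟩ : ∃ x, x ∈ l.head? := ⟨l.head hl0, List.head?_eq_some_head hl0⟩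
  obtain ⟨y, hy⟩ : ∃ y, y ∈ l.getLast? := ⟨l.getLast hl0, List.getLast?_eq_some_getLast hl0⟩
  have hNx : ∀ w, G.Adj x w → w ∈ l := fun w hw => hl.mem_of_adj_head hD hx hw
  have hNy : ∀ w, G.Adj y w → w ∈ l := fun w hw => by
    simpa using hl.reverse.mem_of_adj_head hD (x := y) (by simpa using hy) hw
  -- Without crossing chords, `deg x + deg y + 1 ≤ l.length < n`. With them, the vertices of `l`
  -- form a cycle; as the component is larger, an edge leaves this cycle, and opening it there gives
  -- a longer path.
  by_cases hc : l.IsChain (fun a b => ¬(G.Adj x b ∧ G.Adj y a))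
  · have h := List.IsChain.countP_tail_add_countP_lt (fun w => decide (G.Adj x w))
      (fun w => decide (G.Adj y w)) (l := l) (by simpa using hc) hl0 (by
        intro w hw
        rw [Option.mem_unique hw hy]
        simp)
    have hx' : G.degree x ≤ l.tail.countP (fun w => G.Adj x w) := by
      convert degree_le_countP (G := G) (l := l.tail) (x := x) ?_
      intro w hw
      obtain ⟨x', t, rfl⟩ := List.exists_cons_of_ne_nil hl0
      obtain rfl : x' = x := by simpa using hx
      exact (List.mem_cons.1 (hNx w hw)).resolve_left hw.ne'
    have hy' : G.degree y ≤ l.countP (fun w => G.Adj y w) := by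
      convert degree_le_countP (G := G) hNy
    rcases le_total (G.degree x) (G.degree y) with hxy | hxy
    · exact ⟨x, by omega⟩
    · exact ⟨y, by omega⟩
  · exfalso
    rw [List.isChain_iff_forall_rel_of_append_cons_cons] at hc
    push Not at hc
    obtain ⟨b, c, l₁, l₂, rfl, hxc, hyb⟩ := hc
    have hch := List.isChain_append_cons_cons.1 hl.chain
    have hpC : ((l₁ ++ [b]) ++ (c :: l₂).reverse).Perm (l₁ ++ b :: c :: l₂) := by
      have := (List.reverse_perm (c :: l₂)).append_left (l₁ ++ [b])
      simpa using this
    have hyc : y ∈ (c :: l₂).getLast? := by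
      simpa [List.getLast?_append, List.getLast?_cons] using hy
    have hC : ((l₁ ++ [b]) ++ (c :: l₂).reverse).IsChain G.Adj := by
      refine List.isChain_append.2 ⟨hch.1, isChain_adj_reverse hch.2.2, ?_⟩
      intro u hu v hv
      rw [List.head?_reverse] at hv
      rw [Option.mem_unique hv hyc]
      simp at hu
      exact hu ▸ hyb.symm
    obtain ⟨w, hwD, hwl⟩ : ∃ w ∈ D, w ∉ l₁ ++ b :: c :: l₂ := by
      by_contra! hn
      have h₁ := Set.ncard_le_ncard (t := ((l₁ ++ b :: c :: l₂).toFinset : Set α))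
        (fun w hw => List.mem_toFinset.2 (hn w hw))
      rw [Set.ncard_coe_finset] at h₁
      have h₂ := List.toFinset_card_le (l₁ ++ b :: c :: l₂)
      omega
    have hxl := List.mem_of_mem_head? hx
    obtain ⟨p⟩ : G.Reachable x w := (Reachable.symm (hl.mem x hxl)).trans hwD
    obtain ⟨e, -, he₁, he₂⟩ := p.exists_boundary_dart {u | u ∈ l₁ ++ b :: c :: l₂} hxl hwl
    obtain ⟨L, hL, hLc⟩ := exists_perm_cons_isChain hC (c := e.fst) (by
      intro u hu v hv
      have hu' : u = x := by
        refine Option.mem_unique (o := (l₁ ++ b :: c :: l₂).head?) ?_ hx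
        simpa [List.head?_append] using hu
      have hv' : v = c := by
        simpa [List.getLast?_append, List.getLast?_cons] using hv.symm
      rw [hu', hv']
      exact hxc.symm) (hpC.mem_iff.2 he₁)
    have hL' := hL.trans hpC
    have := hl.le (e.snd :: e.fst :: L) ⟨?_, ?_, ?_⟩
    · have h := hL'.length_eq
      rw [List.length_cons, h] at this
      omega
    · exact List.nodup_cons.2 ⟨fun h => he₂ (hL'.mem_iff.1 h), hL'.nodup_iff.2 hl.nodup⟩
    · exact List.isChain_cons_cons.2 ⟨e.adj.symm, hLc⟩
    · intro u hu
      rcases List.mem_cons.1 hu with rfl | hu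
      · exact hD _ (hl.mem _ he₁) _ e.adj
      · exact hl.mem u (hL'.mem_iff.1 hu)

end LowDegree

/-! ### Long paths in the complement -/

section ComplementPaths

variable {α : Type*} {G : SimpleGraph α}

theorem adj_or_compl_adj (G : SimpleGraph α) (x y : α) (h : x ≠ y) : G.Adj x y ∨ Gᶜ.Adj x y := by
  rw [compl_adj]
  tauto

theorem IsPathList.exists_length_eq {W : Set α} {l : List α} (h : G.IsPathList W l) {m : ℕ}
    (hm : m ≤ l.length) : ∃ l', G.IsPathList W l' ∧ l'.length = m :=
  ⟨l.take m, h.infix (List.take_prefix m l).isInfix, by simpa using hm⟩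

theorem IsLongestPathList.le_length_add_half [Finite α] {U : Finset α} {Q : List α}
    (hQ : Gᶜ.IsLongestPathList (U : Set α) Q) {m n : ℕ}
    (hG : ¬ (pathGraph n).IsContained G) (hU : U.Nonempty) (hmn : n + 1 ≤ m)
    (hm : m + n / 2 ≤ U.card + 2) : U.card + 1 ≤ Q.length + n / 2 := by
  classical
  obtain ⟨P, hP⟩ := exists_isLongestPathList G (U : Set α)
  have hPn := hP.length_lt hG
  rcases le_total P.length Q.length with h | h
  · have := hP.card_lt (adj_or_compl_adj G) hQ hU h
    omega
  · rcases h.eq_or_lt with h | h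
    · have := hP.card_lt (adj_or_compl_adj G) hQ hU h.ge
      omega
    -- Contradictory case: with both orders below `n` and `Q` the shorter, `U` would be too small.
    have := hQ.card_lt (fun x y hxy => (adj_or_compl_adj G x y hxy).symm) hP hU h.le
    omega

/-- If `G` has no path on `n` vertices, its complement has a path on `m` vertices in every set
of at least `m + n / 2 - 1` vertices. -/
theorem exists_compl_isPathList_of_card [Finite α] {U : Finset α} {m n : ℕ}
    (hG : ¬ (pathGraph n).IsContained G) (hmn : n + 1 ≤ m) (hn : 2 ≤ n)
    (hm : m + n / 2 ≤ U.card + 1) : ∃ l, Gᶜ.IsPathList (U : Set α) l ∧ l.length = m := by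
  obtain ⟨Q, hQ⟩ := exists_isLongestPathList Gᶜ (U : Set α)
  refine hQ.exists_length_eq ?_
  have := hQ.le_length_add_half hG (Finset.card_pos.1 (by omega)) hmn (by omega)
  omega

-- All vertices of `U` off a longest path `Q` of `Gᶜ` are `G`-adjacent to its head, so share a
-- component. For such an `s`, the `k` vertices unreachable from it lie on `Q`, while more than half
-- of `Q` is adjacent to `s`; hence `Q.length > 2 * k`.
open Classical in
theorem exists_compl_isPathList_of_reachable [Finite α] {U : Finset α} {k : ℕ}
    (hU : 2 * k ≤ U.card) (hk : ∀ s ∈ U, k ≤ {x ∈ U | ¬ G.Reachable s x}.card) :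
    ∃ l, Gᶜ.IsPathList (U : Set α) l ∧ l.length = 2 * k := by
  obtain ⟨Q, hQ⟩ := exists_isLongestPathList Gᶜ (U : Set α)
  refine hQ.exists_length_eq ?_
  by_contra! hlt
  have hGH := adj_or_compl_adj G
  obtain ⟨s, hs, hsQ⟩ : ∃ s ∈ U, s ∉ Q := by
    by_contra! hn
    have h₁ := Finset.card_le_card (t := Q.toFinset) fun x hx => List.mem_toFinset.2 (hn x hx)
    have h₂ := List.toFinset_card_le Q
    omega
  have hcount := hQ.length_lt_two_mul_countP hGH hs hsQ
  have hQ0 : Q ≠ [] := by rintro rfl; simp at hcount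
  have hy : Q.head hQ0 ∈ Q.head? := List.head?_eq_some_head hQ0
  have hsub : {x ∈ U | ¬ G.Reachable s x} ⊆ (Q.filter fun x => ¬ G.Adj s x).toFinset := by
    intro x hx
    rw [Finset.mem_filter] at hx
    have hsx : ¬ G.Adj s x := fun h => hx.2 h.reachable
    have hxQ : x ∈ Q := by
      by_contra hxQ
      exact hx.2 ((hQ.adj_head hGH hs hsQ _ hy).reachable.trans
        (hQ.adj_head hGH hx.1 hxQ _ hy).symm.reachable)
    simp [hxQ, hsx]
  have h₁ := (hk s hs).trans ((Finset.card_le_card hsub).trans (List.toFinset_card_le _))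
  rw [← List.countP_eq_length_filter] at h₁
  have h₂ := List.length_eq_countP_add_countP (fun x => decide (G.Adj s x)) (l := Q)
  simp only [decide_eq_true_eq] at h₂
  omega

end ComplementPaths

/-! ### Finding the hub -/

section Hub

variable {α : Type*} {G H : SimpleGraph α} {W : Set α} {Q T : List α}

/-- When `G` has no path longer than the alternating ones, the last vertex of a longest path `Q`
of `H` has all its `G`-neighbors among the vertices `T` that `Q` misses. -/
theorem IsLongestPathList.mem_of_adj_getLast (hGH : ∀ x y, x ≠ y → G.Adj x y ∨ H.Adj x y)
    (hG : ¬ (pathGraph (2 * T.length + 2)).IsContained G)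
    (hQ : H.IsLongestPathList W Q) (hT : T.Nodup) (hTW : ∀ s ∈ T, s ∈ W)
    (hTQ : ∀ s ∈ T, s ∉ Q) (hT0 : T ≠ []) (hlen : 2 * T.length + 2 ≤ Q.length) {z w : α}
    (hz : z ∈ Q.getLast?) (hzw : G.Adj z w) : w ∈ T := by
  obtain ⟨L, hL, hTL, hlenL⟩ := hQ.exists_odd_path hGH hT hTW hTQ hT0 (by omega) hz
  have hLG : G.IsPathList Set.univ (z :: L) := hL.of_between.mono (Set.subset_univ _)
  -- The alternating path has `2 * T.length + 1` vertices, the most that `G` allows.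
  have hwL : w ∈ z :: L := by
    by_contra hn
    have h : G.IsPathList Set.univ (w :: z :: L) :=
      ⟨List.nodup_cons.2 ⟨hn, hLG.nodup⟩, List.isChain_cons_cons.2 ⟨hzw.symm, hLG.chain⟩, by simp⟩
    have := h.length_lt hG
    simp only [List.length_cons] at this
    omega
  have hwL : w ∈ L := (List.mem_cons.1 hwL).resolve_left hzw.ne'
  by_contra hwT
  obtain ⟨L₁, L₂, rfl⟩ := List.append_of_mem hwL
  obtain ⟨s, hs⟩ : ∃ s, s ∈ (z :: L₁).getLast? := ⟨_, List.getLast?_cons⟩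
  have hsw : (G.between {x | x ∈ T} {x | x ∈ T}ᶜ).Adj s w := by
    have h := hL.chain
    rw [← List.cons_append, List.isChain_append] at h
    exact h.2.2 s hs w rfl
  have hsT : s ∈ T := by
    rcases hsw.2 with h | h
    exacts [h.1, (hwT h.2).elim]
  obtain ⟨u, huQ, hsu, huL⟩ := hQ.exists_adj_notMem hGH hT hTQ (hTW s hsT) (hTQ s hsT)
    (L := z :: (L₁ ++ w :: L₂)) (fun x hx => List.mem_cons_of_mem _ (hTL hx))
    (by rw [List.length_cons]; omega)
  have hp : ((z :: L₁).reverse ++ w :: L₂).Perm (z :: (L₁ ++ w :: L₂)) :=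
    (List.reverse_perm (z :: L₁)).append_right _
  -- Rotation along the chord `zw`: the predecessor `s` of `w` becomes an end, and its unused
  -- neighbor `u` makes the path too long.
  have h : G.IsPathList Set.univ (u :: ((z :: L₁).reverse ++ w :: L₂)) := by
    have hc := hLG.chain
    rw [← List.cons_append, List.isChain_append] at hc
    refine ⟨List.nodup_cons.2 ⟨fun h => huL (hp.mem_iff.1 h), hp.nodup_iff.2 hLG.nodup⟩,
      (List.isChain_append.2 ⟨isChain_adj_reverse hc.1, hc.2.1, ?_⟩).cons ?_, by simp⟩
    · intro x hx y hy
      simp at hx hy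
      subst hx hy
      exact hzw
    · intro y hy
      have hy' : y ∈ (z :: L₁).getLast? := by
        simpa [List.head?_append, List.getLast?_cons] using hy
      rw [Option.mem_unique hy' hs]
      exact hsu.symm
  have := h.length_lt hG
  rw [List.length_cons, hp.length_eq, List.length_cons, hlenL] at this
  omega

open Classical in
/-- The tight case: a vertex of degree `d` in a graph without a path on `2 * d + 2` vertices whose
non-neighbors carry no path on `2 * k` vertices of the complement. -/
theorem exists_hub_of_degree_eq [Fintype α] {d k : ℕ} (hd : 1 ≤ d) (hdk : d + 2 ≤ k)
    (hcard : Fintype.card α = 2 * k + 2 * d) (hG : ¬ (pathGraph (2 * d + 2)).IsContained G)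
    {v : α} (hv : G.degree v = d) :
    ∃ v l, Gᶜ.IsPathList {w | Gᶜ.Adj v w} l ∧ l.length = 2 * k := by
  have hGH := adj_or_compl_adj G
  have hU : (Gᶜ.neighborFinset v).card = 2 * k + d - 1 := by
    rw [card_neighborFinset_eq_degree, degree_compl, hv, hcard]
    omega
  have hUW : ((Gᶜ.neighborFinset v : Finset α) : Set α) = {w | Gᶜ.Adj v w} := by
    ext w; simp
  obtain ⟨Q, hQ⟩ := exists_isLongestPathList Gᶜ ((Gᶜ.neighborFinset v : Finset α) : Set α)
  by_cases hQk : 2 * k ≤ Q.length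
  · obtain ⟨l, hl, hlk⟩ := hQ.exists_length_eq hQk
    exact ⟨v, l, hUW ▸ hl, hlk⟩
  have hQlen := hQ.le_length_add_half (m := 2 * k) hG (Finset.card_pos.1 (by omega)) (by omega)
    (by omega)
  -- The bound on `Q` and the failure of `hQk` force `Q.length = 2 * k - 1`.
  have hTcard : (Gᶜ.neighborFinset v \ Q.toFinset).card = d := by
    rw [Finset.card_sdiff_of_subset fun x hx => hQ.mem x (List.mem_toFinset.1 hx),
      List.toFinset_card_of_nodup hQ.nodup]
    omega
  generalize hTdef : (Gᶜ.neighborFinset v \ Q.toFinset).toList = T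
  have hT : T.Nodup := hTdef ▸ Finset.nodup_toList _
  have hTlen : T.length = d := by rw [← hTdef, Finset.length_toList, hTcard]
  have hTU : ∀ s ∈ T, s ∈ Gᶜ.neighborFinset v ∧ s ∉ Q := by
    intro s hs
    rw [← hTdef, Finset.mem_toList, Finset.mem_sdiff, List.mem_toFinset] at hs
    exact hs
  have hT0 : T ≠ [] := by rintro rfl; simp at hTlen; omega
  obtain ⟨y, Q', rfl⟩ := List.exists_cons_of_ne_nil (l := Q) (by
    rintro rfl; rw [List.length_nil] at hQlen; omega)
  rcases List.eq_nil_or_concat' Q' with rfl | ⟨M, z, rfl⟩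
  · rw [List.length_singleton] at hQlen; omega
  have hy : ∀ w, G.Adj y w → w ∈ T := fun w => by
    refine hQ.reverse.mem_of_adj_getLast hGH (hTlen ▸ hG) hT (fun s hs => (hTU s hs).1)
      (fun s hs => ?_) hT0 ?_ ?_
    · rw [List.mem_reverse]
      exact (hTU s hs).2
    · rw [List.length_reverse]; omega
    · rw [List.getLast?_reverse]; rfl
  have hz : ∀ w, G.Adj z w → w ∈ T := fun w => by
    refine hQ.mem_of_adj_getLast hGH (hTlen ▸ hG) hT (fun s hs => (hTU s hs).1)
      (fun s hs => (hTU s hs).2) hT0 (by omega) ?_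
    simp [List.getLast?_cons]
  obtain ⟨u, hu⟩ : ∃ u, G.Adj v u := by
    have : 0 < G.degree v := by omega
    exact (G.degree_pos_iff_exists_adj v).1 this
  have huU : u ∉ Gᶜ.neighborFinset v := by simp [hu]
  have hvU : v ∉ Gᶜ.neighborFinset v := by simp
  have hQU : ∀ x ∈ y :: (M ++ [z]), x ∈ Gᶜ.neighborFinset v := hQ.mem
  have hvQ : ∀ x ∈ y :: (M ++ [z]), Gᶜ.Adj v x := fun x hx => by simpa using hQU x hx
  have huQ : u ∉ y :: (M ++ [z]) := fun h => huU (hQU u h)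
  have hvQ' : v ∉ y :: (M ++ [z]) := fun h => hvU (hQU v h)
  have hnd := hQ.nodup
  have hch := hQ.chain
  -- The new hub `y` leaves `Q`; `v` replaces it and `u` is appended, so there are `2 * k` vertices.
  -- Neither `u` nor `v` lies in `T`, so neither is a `G`-neighbor of `y` or `z`.
  refine ⟨y, v :: ((M ++ [z]) ++ [u]), ⟨?_, ?_, ?_⟩, ?_⟩
  · rw [List.nodup_cons, List.nodup_append]
    rw [List.nodup_cons] at hnd
    refine ⟨?_, hnd.2, by simp, ?_⟩
    · rw [List.mem_append, not_or]
      exact ⟨fun h => hvQ' (List.mem_cons_of_mem _ h), by simpa using hu.ne⟩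
    · rintro a ha b hb rfl
      rw [List.mem_singleton] at hb
      exact huQ (hb ▸ List.mem_cons_of_mem _ ha)
  · refine List.IsChain.cons (List.isChain_append.2 ⟨hch.tail, by simp, ?_⟩) ?_
    · intro a ha b hb
      simp at ha hb
      subst ha hb
      rw [compl_adj]
      refine ⟨fun h => huQ (by simp [h]), fun h => huU (hTU _ (hz _ h)).1⟩
    · intro a ha
      refine hvQ a (List.mem_cons_of_mem _ ?_)
      have : a ∈ (M ++ [z]).head? := by
        rw [List.append_assoc] at ha
        cases M <;> simpa using ha
      exact List.mem_of_mem_head? this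
  · intro x hx
    change Gᶜ.Adj y x
    rw [compl_adj]
    have hx' : x = v ∨ x ∈ M ++ [z] ∨ x = u := by simpa [or_assoc] using hx
    rcases hx' with rfl | hx | rfl
    · exact ⟨fun h => hvQ' (by simp [h]), fun h => hvU (hTU _ (hy _ h)).1⟩
    · refine ⟨?_, fun h => (hTU _ (hy _ h)).2 (List.mem_cons_of_mem _ hx)⟩
      rintro rfl
      exact (List.nodup_cons.1 hnd).1 hx
    · exact ⟨fun h => huQ (by simp [h]), fun h => huU (hTU _ (hy _ h)).1⟩
  · simp only [List.length_cons, List.length_append, List.length_nil] at hQlen hQk ⊢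
    omega

-- Two components cannot cover `G`, so besides a smallest component `K a` and any other `K b` there
-- is a third. Hence the remainder has at least `(K a).card` vertices, and also at least `2 * k - 1
-- - (K a).card`; so it has at least `k`.
open Classical in
theorem exists_hub_of_card_reachable_lt [Fintype α] {n k : ℕ} (hnk : n + 1 ≤ 2 * k)
    (hkn : 2 * k ≤ 2 * n - 1) (hcard : Fintype.card α = 2 * k + n - 2)
    (hn : ∀ a, (Finset.univ.filter (G.Reachable a)).card < n) :
    ∃ v l, Gᶜ.IsPathList {w | Gᶜ.Adj v w} l ∧ l.length = 2 * k := by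
  let K : α → Finset α := fun a => Finset.univ.filter (G.Reachable a)
  have hn : ∀ a, (K a).card < n := hn
  have hK : ∀ a x, x ∈ K a ↔ G.Reachable a x := fun a x => by simp [K]
  have hdisj : ∀ a b, b ∉ K a → Disjoint (K a) (K b) := by
    intro a b hb
    rw [Finset.disjoint_left]
    intro x hxa hxb
    rw [hK] at *
    exact hb (hxa.trans hxb.symm)
  have : Nonempty α := Fintype.card_pos_iff.1 (by omega)
  obtain ⟨a, ha⟩ := Finite.exists_min fun a => (K a).card
  have hthird : ∀ b, b ∉ K a → ∃ c, c ∉ K a ∧ c ∉ K b := by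
    intro b hb
    by_contra! h
    have h₁ : (Finset.univ : Finset α) ⊆ K a ∪ K b := by
      intro x _
      by_cases hx : x ∈ K a
      · exact Finset.mem_union_left _ hx
      · exact Finset.mem_union_right _ (h x hx)
    have h₂ := (Finset.card_le_card h₁).trans (Finset.card_union_le _ _)
    rw [Finset.card_univ] at h₂
    have := hn a
    have := hn b
    omega
  have hUcard : ((K a)ᶜ).card = Fintype.card α - (K a).card := Finset.card_compl _
  have hrest : ∀ b, b ∉ K a →
      ({x ∈ (K a)ᶜ | ¬ G.Reachable b x}).card + (K b).card + (K a).card = Fintype.card α := by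
    intro b hb
    have h₁ : {x ∈ (K a)ᶜ | ¬ G.Reachable b x} = (K a ∪ K b)ᶜ := by
      ext x
      simp only [Finset.mem_filter, Finset.mem_compl, Finset.mem_union, hK, not_or]
    have h₂ := Finset.card_add_card_compl (K a ∪ K b)
    rw [Finset.card_union_of_disjoint (hdisj a b hb)] at h₂
    rw [h₁]
    omega
  have hthird' : ∀ b, b ∉ K a → (K a).card ≤ ({x ∈ (K a)ᶜ | ¬ G.Reachable b x}).card := by
    intro b hb
    obtain ⟨c, hca, hcb⟩ := hthird b hb
    refine (ha c).trans (Finset.card_le_card fun x hx => ?_)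
    rw [Finset.mem_filter, Finset.mem_compl, ← hK]
    exact ⟨Finset.disjoint_right.1 (hdisj a c hca) hx, Finset.disjoint_right.1 (hdisj b c hcb) hx⟩
  obtain ⟨b, hb⟩ : ∃ b, b ∉ K a := by
    by_contra! h
    have h₂ := Finset.card_le_card (s := Finset.univ) (t := K a) fun x _ => h x
    rw [Finset.card_univ] at h₂
    have := hn a
    omega
  obtain ⟨l, hl, hlk⟩ := exists_compl_isPathList_of_reachable (G := G) (U := (K a)ᶜ) (k := k)
    (by
      have h₁ := hrest b hb
      have h₂ := hthird' b hb
      have h₃ := ha b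
      omega)
    (by
      intro s hs
      rw [Finset.mem_compl] at hs
      have h₁ := hrest s hs
      have h₂ := hthird' s hs
      have h₃ := hn s
      have h₄ : k ≤ ({x ∈ (K a)ᶜ | ¬ G.Reachable s x}).card := by omega
      convert h₄)
  refine ⟨a, l, hl.mono fun x hx => ?_, hlk⟩
  have hx' : ¬ G.Reachable a x := by simpa [hK] using hx
  change Gᶜ.Adj a x
  rw [compl_adj]
  refine ⟨?_, fun h => hx' h.reachable⟩
  rintro rfl
  exact hx' (Reachable.refl _)

/-- If `G` has no path on `n` vertices, then the complement of `G` contains the join of a vertex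
and a path on `2 * k` vertices. -/
theorem exists_hub [Fintype α] {n k : ℕ} (hnk : n + 1 ≤ 2 * k)
    (hkn : 2 * k ≤ 2 * n - 1) (hcard : Fintype.card α = 2 * k + n - 2)
    (hG : ¬ (pathGraph n).IsContained G) :
    ∃ v l, Gᶜ.IsPathList {w | Gᶜ.Adj v w} l ∧ l.length = 2 * k := by
  classical
  by_cases hbig : ∀ a, (Finset.univ.filter (G.Reachable a)).card < n
  · exact exists_hub_of_card_reachable_lt hnk hkn hcard hbig
  push Not at hbig
  obtain ⟨a, ha⟩ := hbig
  obtain ⟨v, hv⟩ := exists_two_mul_degree_add_two_le hG a (by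
    rw [← Set.ncard_coe_finset] at ha
    simpa using ha)
  -- Otherwise `2 * deg v + 3 ≤ n`, which leaves the `2 * k + n / 2 - 1` non-neighbors that the path
  -- bound needs.
  by_cases hvn : n = 2 * G.degree v + 2
  · exact exists_hub_of_degree_eq (d := G.degree v) (by omega) (by omega) (by omega)
      (hvn ▸ hG) (by convert rfl)
  · have hU : (Gᶜ.neighborFinset v).card = 2 * k + n - 2 - 1 - G.degree v := by
      rw [card_neighborFinset_eq_degree, degree_compl, hcard]
    obtain ⟨l, hl, hlk⟩ := exists_compl_isPathList_of_card (U := Gᶜ.neighborFinset v) (m := 2 * k)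
      hG hnk (by omega) (by omega)
    exact ⟨v, l, hl.mono fun w hw => by simpa using hw, hlk⟩

end Hub

/-! ### Linear forests: embedding in a path, and perfect matchings -/

section LinearForest

variable {V : Type*} {F : SimpleGraph V}

theorem ConnectedComponent.exists_list {c : F.ConnectedComponent} {k : ℕ}
    (e : c.toSimpleGraph ≃g pathGraph k) :
    ∃ l : List V, l.Nodup ∧ (∀ x, x ∈ l ↔ F.connectedComponentMk x = c) ∧
      ∀ x ∈ l, ∀ y ∈ l, F.Adj x y → [x, y] <:+: l ∨ [y, x] <:+: l := by
  have hinf : ∀ i j : Fin k, i.val + 1 = j.val →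
      [(e.symm i).1, (e.symm j).1] <:+: (List.finRange k).map fun i => (e.symm i).1 := by
    intro i j hij
    have h := List.isChain_iff_getElem.1
      (List.isChain_isInfix ((List.finRange k).map fun i => (e.symm i).1)) i.val
      (by simp; omega)
    have hj : j = ⟨i.val + 1, by omega⟩ := Fin.ext hij.symm
    simpa [hj] using h
  refine ⟨(List.finRange k).map fun i => (e.symm i).1, ?_, ?_, ?_⟩
  · exact (List.nodup_finRange k).map (Subtype.val_injective.comp e.symm.injective)
  · intro x
    simp only [List.mem_map, List.mem_finRange, true_and]
    constructor
    · rintro ⟨i, rfl⟩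
      exact (e.symm i).2
    · intro hx
      exact ⟨e ⟨x, hx⟩, by simp⟩
  · intro x hx y hy hxy
    simp only [List.mem_map, List.mem_finRange, true_and] at hx hy
    obtain ⟨i, rfl⟩ := hx
    obtain ⟨j, rfl⟩ := hy
    have h : c.toSimpleGraph.Adj (e.symm i) (e.symm j) := hxy
    rw [e.symm.map_adj_iff, pathGraph_adj] at h
    exact h.imp (hinf i j) (hinf j i)

/-- The vertices of a linear forest can be listed so that adjacent vertices are consecutive. -/
theorem IsLinearForest.exists_list [Finite V] (hF : F.IsLinearForest) :
    ∃ l : List V, l.Nodup ∧ (∀ x, x ∈ l) ∧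
      ∀ x y, F.Adj x y → [x, y] <:+: l ∨ [y, x] <:+: l := by
  have := Fintype.ofFinite F.ConnectedComponent
  have h : ∀ c : F.ConnectedComponent, ∃ l : List V, l.Nodup ∧
      (∀ x, x ∈ l ↔ F.connectedComponentMk x = c) ∧
      ∀ x ∈ l, ∀ y ∈ l, F.Adj x y → [x, y] <:+: l ∨ [y, x] <:+: l := by
    intro c
    obtain ⟨k, ⟨e⟩⟩ := hF.2 c
    exact ConnectedComponent.exists_list e
  choose L hnd hmem hadj using h
  refine ⟨(Finset.univ : Finset F.ConnectedComponent).toList.flatMap L, ?_, ?_, ?_⟩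
  · rw [List.nodup_flatMap]
    refine ⟨fun c _ => hnd c, (Finset.nodup_toList _).imp ?_⟩
    intro c c' hcc x hx hx'
    exact hcc (((hmem c x).1 hx).symm.trans ((hmem c' x).1 hx'))
  · intro x
    simp [hmem]
  · intro x y hxy
    have hinf : L (F.connectedComponentMk x) <:+:
        (Finset.univ : Finset F.ConnectedComponent).toList.flatMap L := by
      obtain ⟨s, t, hst⟩ := List.append_of_mem
        (Finset.mem_toList.2 (Finset.mem_univ (F.connectedComponentMk x)))
      exact ⟨s.flatMap L, t.flatMap L, by rw [hst]; simp⟩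
    exact (hadj _ x ((hmem _ _).2 rfl) y
      ((hmem _ _).2 (ConnectedComponent.sound hxy.symm.reachable)) hxy).imp
      (fun h => h.trans hinf) (fun h => h.trans hinf)

/-- A linear forest lies in every path with the same number of vertices; adding a vertex adjacent to
the whole path gives the join. -/
theorem IsLinearForest.join_isContained [Fintype V] (hF : F.IsLinearForest) {α : Type*}
    {H : SimpleGraph α} {v : α} {L : List α} (hL : H.IsPathList {w | H.Adj v w} L)
    (hlen : L.length = Fintype.card V) :
    (join (⊤ : SimpleGraph (Fin 1)) F).IsContained H := by
  classical
  obtain ⟨l, hnd, hmem, hadj⟩ := hF.exists_list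
  have hl : l.length = L.length := by
    rw [hlen, ← List.toFinset_card_of_nodup hnd, ← Finset.card_univ]
    congr 1
    ext x
    simp [hmem]
  have hidx : ∀ x, l.idxOf x < L.length := fun x => hl ▸ List.idxOf_lt_length_iff.2 (hmem x)
  have hcons : ∀ x y, [x, y] <:+: l → l.idxOf y = l.idxOf x + 1 := by
    rintro x y ⟨s, t, rfl⟩
    have hnd' : (s ++ (x :: y :: t)).Nodup := by simpa using hnd
    rw [List.nodup_append] at hnd'
    have hxs : x ∉ s := fun h => hnd'.2.2 x h x (by simp) rfl
    have hys : y ∉ s := fun h => hnd'.2.2 y h y (by simp) rfl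
    have hxy : x ≠ y := by rintro rfl; simp at hnd'
    simp [List.idxOf_append, hxs, hys, hxy, Nat.add_comm]
  have hφ : ∀ x y, [x, y] <:+: l → H.Adj (L[l.idxOf x]'(hidx x)) (L[l.idxOf y]'(hidx y)) := by
    intro x y h
    have h' := hcons x y h
    have := List.isChain_iff_getElem.1 hL.chain (l.idxOf x) (h' ▸ hidx y)
    simpa only [h'] using this
  have hv : ∀ x, H.Adj v (L[l.idxOf x]'(hidx x)) := fun x => hL.mem _ (List.getElem_mem _)
  refine ⟨⟨⟨Sum.elim (fun _ => v) fun x => L[l.idxOf x]'(hidx x), ?_⟩, ?_⟩⟩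
  · rintro (i | x) (j | y) h
    · simp [join, Subsingleton.elim i j] at h
    · exact hv y
    · exact (hv x).symm
    · have hxy : F.Adj x y := by simpa [join] using h
      exact (hadj x y hxy).elim (hφ x y) fun h => (hφ y x h).symm
  · rintro (i | x) (j | y) h
    · rw [Subsingleton.elim i j]
    · exact ((hv y).ne h).elim
    · exact ((hv x).ne h.symm).elim
    · have h : L[l.idxOf x]'(hidx x) = L[l.idxOf y]'(hidx y) := h
      rw [List.Nodup.getElem_inj_iff hL.nodup] at h
      rw [(List.idxOf_inj (hmem x)).1 h]

/-- The perfect matching of an even path, pairing `2j` with `2j + 1`. -/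
theorem exists_injective_pathGraph_adj {k : ℕ} (hk : Even k) :
    ∃ σ : Fin k → Fin k, Function.Injective σ ∧ ∀ i, (pathGraph k).Adj i (σ i) := by
  obtain ⟨j, rfl⟩ := hk
  refine ⟨fun i => if h : i.val % 2 = 0 then ⟨i.val + 1, by omega⟩ else ⟨i.val - 1, by omega⟩,
    ?_, ?_⟩
  · intro a b hab
    simp only at hab
    split_ifs at hab <;> simp only [Fin.mk.injEq] at hab <;> ext <;> omega
  · intro i
    rw [pathGraph_adj]
    by_cases h : i.val % 2 = 0
    · simp [h]
    · simp only [h, dite_false]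
      omega

theorem IsLinearForest.exists_injective_adj (hF : F.IsLinearForest)
    (heven : ∀ c : F.ConnectedComponent, Even (Nat.card c.supp)) :
    ∃ τ : V → V, Function.Injective τ ∧ ∀ x, F.Adj x (τ x) := by
  have h : ∀ c : F.ConnectedComponent, ∃ g : c → c, Function.Injective g ∧
      ∀ x : c, F.Adj x.1 (g x).1 := by
    intro c
    obtain ⟨k, ⟨e⟩⟩ := hF.2 c
    have hk : Even k := by
      have h₁ : Nat.card c.supp = k := by
        rw [← Nat.card_fin k]
        exact Nat.card_congr e.toEquiv
      exact h₁ ▸ heven c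
    obtain ⟨σ, hσ, hadj⟩ := exists_injective_pathGraph_adj hk
    refine ⟨fun x => e.symm (σ (e x)), e.symm.injective.comp (hσ.comp e.injective), fun x => ?_⟩
    have h₁ : c.toSimpleGraph.Adj (e.symm (e x)) (e.symm (σ (e x))) :=
      e.symm.map_adj_iff.2 (hadj _)
    rw [e.symm_apply_apply] at h₁
    exact h₁
  choose g hg hadj using h
  have hadj' : ∀ x, F.Adj x (g (F.connectedComponentMk x) ⟨x, rfl⟩).1 := fun x => hadj _ ⟨x, rfl⟩
  refine ⟨fun x => (g (F.connectedComponentMk x) ⟨x, rfl⟩).1, ?_, hadj'⟩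
  have hinj : ∀ (c c' : F.ConnectedComponent) (x : c) (y : c'), c = c' → (g c x).1 = (g c' y).1 → x.1 = y.1 := by
    rintro c _ x y rfl hxy
    rw [hg c (Subtype.ext hxy)]
  intro x y hxy
  refine hinj _ _ ⟨x, rfl⟩ ⟨y, rfl⟩ (ConnectedComponent.sound ?_) hxy
  simp only at hxy
  exact (hadj' x).reachable.trans (hxy ▸ (hadj' y).reachable.symm)

/-- `I` and its image under `τ` are disjoint and equinumerous. -/
theorem two_mul_card_le_of_injective_adj [Fintype V] {τ : V → V} (hτ : Function.Injective τ)
    (hadj : ∀ x, F.Adj x (τ x)) {I : Finset V} (hI : ∀ x ∈ I, ∀ y ∈ I, ¬ F.Adj x y) :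
    2 * I.card ≤ Fintype.card V := by
  classical
  have hdisj : Disjoint I (I.map ⟨τ, hτ⟩) := by
    rw [Finset.disjoint_right]
    intro y hy hyI
    obtain ⟨x, hx, rfl⟩ := Finset.mem_map.1 hy
    exact hI x hx _ hyI (hadj x)
  have := Finset.card_le_univ (I ∪ I.map ⟨τ, hτ⟩)
  rw [Finset.card_union_of_disjoint hdisj, Finset.card_map] at this
  omega

theorem even_card_of_even_components [Fintype V]
    (heven : ∀ c : F.ConnectedComponent, Even (Nat.card c.supp)) : Even (Fintype.card V) := by
  classical
  have := Fintype.ofFinite F.ConnectedComponent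
  rw [← Finset.card_univ, Finset.card_eq_sum_card_fiberwise (f := F.connectedComponentMk)
    (t := Finset.univ) fun x _ => Finset.mem_coe.2 (Finset.mem_univ _)]
  refine Finset.even_sum _ fun c _ => ?_
  have h : (Finset.univ.filter fun x => F.connectedComponentMk x = c).card = Nat.card c.supp := by
    rw [Nat.card_eq_fintype_card, Fintype.card_subtype]
    simp only [ConnectedComponent.mem_supp_iff]
  exact h ▸ heven c

end LinearForest

/-! ### The extremal graph -/

section LowerBound

/-- The complement of the pulled-back complete graph is a disjoint union of cliques, so a path stays
in one class. -/
theorem length_le_of_isPathList_compl_comap {α : Type*} [Fintype α] {cls : α → ℕ} {l : List α}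
    {W : Set α} {b : ℕ} (hb : ∀ c, (Finset.univ.filter fun i => cls i = c).card ≤ b)
    (hl : (((⊤ : SimpleGraph ℕ).comap cls)ᶜ).IsPathList W l) : l.length ≤ b := by
  classical
  cases l with
  | nil => simp
  | cons x l =>
    have : Trans (fun a b => cls a = cls b) (fun a b => cls a = cls b)
        (fun a b => cls a = cls b) := ⟨fun h h' => h.trans h'⟩
    have hc : (x :: l).IsChain fun a b => cls a = cls b := hl.chain.imp fun a b h => by
      by_contra hn
      exact (compl_adj _ _ _).1 h |>.2 hn
    refine le_trans ?_ (hb (cls x))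
    rw [← List.toFinset_card_of_nodup hl.nodup]
    refine Finset.card_le_card fun y hy => ?_
    rw [List.mem_toFinset, List.mem_cons] at hy
    rw [Finset.mem_filter]
    refine ⟨Finset.mem_univ _, ?_⟩
    rcases hy with rfl | hy
    · rfl
    · exact (hc.rel_cons hy).symm

theorem exists_coloring_fin {r n k : ℕ} (hr : r ≤ n + 2 * k) :
    ∃ cls : Fin r → ℕ, (∀ i, cls i < 3) ∧ (Finset.univ.filter fun i => cls i = 0).card ≤ n ∧
      (Finset.univ.filter fun i => cls i = 1).card ≤ k ∧
      (Finset.univ.filter fun i => cls i = 2).card ≤ k := by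
  refine ⟨fun i => if i.val < n then 0 else if i.val < n + k then 1 else 2, ?_, ?_, ?_, ?_⟩
  · intro i
    simp only
    split_ifs <;> omega
  · have := Finset.card_le_card_of_injOn (t := Finset.range n) (Fin.val : Fin r → ℕ)
      (s := Finset.univ.filter fun i : Fin r =>
        (if i.val < n then 0 else if i.val < n + k then 1 else 2) = 0) (by
      intro i hi
      simp only [Finset.coe_filter, Set.mem_ofPred_eq] at hi
      rw [Finset.mem_coe, Finset.mem_range]
      by_contra h
      simp only [h, if_false] at hi
      split_ifs at hi <;> simp_all) Fin.val_injective.injOn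
    simpa using this
  · have := Finset.card_le_card_of_injOn (t := Finset.Ico n (n + k)) (Fin.val : Fin r → ℕ)
      (s := Finset.univ.filter fun i : Fin r =>
        (if i.val < n then 0 else if i.val < n + k then 1 else 2) = 1) (by
      intro i hi
      simp only [Finset.coe_filter, Set.mem_ofPred_eq] at hi
      rw [Finset.mem_coe, Finset.mem_Ico]
      split_ifs at hi <;> simp_all) Fin.val_injective.injOn
    simpa using this
  · have := Finset.card_le_card_of_injOn (t := Finset.Ico (n + k) (n + 2 * k))
      (Fin.val : Fin r → ℕ)
      (s := Finset.univ.filter fun i : Fin r =>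
        (if i.val < n then 0 else if i.val < n + k then 1 else 2) = 2) (by
      intro i hi
      simp only [Finset.coe_filter, Set.mem_ofPred_eq] at hi
      rw [Finset.mem_coe, Finset.mem_Ico]
      have := i.2
      split_ifs at hi <;> simp_all
      omega) Fin.val_injective.injOn
    exact this.trans (by rw [Nat.card_Ico]; omega)

theorem not_join_isContained_comap {V α : Type*} [Fintype V] [Fintype α] {F : SimpleGraph V}
    {cls : α → ℕ} {k : ℕ} (hcard : Fintype.card V = 2 * k)
    (hF : ∀ I : Finset V, (∀ x ∈ I, ∀ y ∈ I, ¬ F.Adj x y) → 2 * I.card ≤ Fintype.card V)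
    (hcls : ∀ i, cls i < 3) (h₁ : (Finset.univ.filter fun i => cls i = 1).card + 1 ≤ k)
    (h₂ : (Finset.univ.filter fun i => cls i = 2).card + 1 ≤ k) :
    ¬ (join (⊤ : SimpleGraph (Fin 1)) F).IsContained ((⊤ : SimpleGraph ℕ).comap cls) := by
  classical
  rintro ⟨f⟩
  have hv : ∀ x, cls (f (Sum.inl 0)) ≠ cls (f (Sum.inr x)) := fun x =>
    f.toHom.map_adj (by simp [join])
  have hadj : ∀ x y, F.Adj x y → cls (f (Sum.inr x)) ≠ cls (f (Sum.inr y)) := fun x y h =>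
    f.toHom.map_adj (by simpa [join] using h)
  let A : ℕ → Finset V := fun c => Finset.univ.filter fun x => cls (f (Sum.inr x)) = c
  have hAF : ∀ c, 2 * (A c).card ≤ 2 * k := fun c => hcard ▸ hF (A c) (by
    intro x hx y hy h
    simp only [A, Finset.mem_filter] at hx hy
    exact hadj x y h (hx.2.trans hy.2.symm))
  have hAc : ∀ c, (A c).card ≤ (Finset.univ.filter fun i => cls i = c).card := fun c =>
    Finset.card_le_card_of_injOn (fun x => f (Sum.inr x)) (by
      intro x hx
      simpa [A] using hx) (fun x _ y _ h => Sum.inr_injective (f.injective h))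
  have hsum : 2 * k ≤ (A 0).card + (A 1).card + (A 2).card := by
    rw [← hcard, ← Finset.card_univ]
    refine (Finset.card_le_card (t := A 0 ∪ A 1 ∪ A 2) fun x _ => ?_).trans
      ((Finset.card_union_le _ _).trans (Nat.add_le_add_right (Finset.card_union_le _ _) _))
    have := hcls (f (Sum.inr x))
    simp only [A, Finset.mem_union, Finset.mem_filter, Finset.mem_univ, true_and]
    omega
  have hempty : (A (cls (f (Sum.inl 0)))).card = 0 := by
    rw [Finset.card_eq_zero, Finset.filter_eq_empty_iff]
    exact fun x _ h => hv x h.symm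
  have hA1 := hAc 1
  have hA2 := hAc 2
  have hF0 := hAF 0
  have hlt := hcls (f (Sum.inl 0))
  generalize cls (f (Sum.inl 0)) = c at hempty hlt
  -- If the hub is in class 0, classes 1 and 2 hold at most `2 * (k - 1)` vertices of `F`; otherwise
  -- class 0 holds at most `k` by independence and the remaining class at most `k - 1`.
  interval_cases c <;> omega

end LowerBound

end SimpleGraph

theorem corollary1 {V : Type*} [Fintype V] (n m : ℕ) (hn : 2 ≤ n) (hm₁ : n + 1 ≤ m)
    (hm₂ : m ≤ 2 * n - 1) (F : SimpleGraph V) (hF : F.IsLinearForest)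
    (hcard : Fintype.card V = m)
    (heven : ∀ c : F.ConnectedComponent, Even (Nat.card c.supp)) :
    SimpleGraph.IsRamseyNumber (SimpleGraph.pathGraph n)
      (SimpleGraph.join (⊤ : SimpleGraph (Fin 1)) F) (m + n - 2) := by
  obtain ⟨k, hk⟩ := (SimpleGraph.even_card_of_even_components heven).two_dvd
  obtain rfl : m = 2 * k := hcard.symm.trans hk
  refine ⟨fun G => or_iff_not_imp_left.2 fun hG => ?_, fun r hr => ?_⟩
  · obtain ⟨v, l, hl, hlen⟩ := SimpleGraph.exists_hub hm₁ hm₂ (Fintype.card_fin _) hG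
    exact hF.join_isContained hl (hlen.trans hcard.symm)
  · by_contra! hlt
    obtain ⟨τ, hτ, hadj⟩ := hF.exists_injective_adj heven
    obtain ⟨cls, hcls, h₀, h₁, h₂⟩ :=
      SimpleGraph.exists_coloring_fin (r := r) (n := n - 1) (k := k - 1) (by omega)
    rcases hr ((⊤ : SimpleGraph ℕ).comap cls)ᶜ with h | h
    · obtain ⟨l, hl, hlen⟩ := SimpleGraph.exists_isPathList_of_isContained h
      have := SimpleGraph.length_le_of_isPathList_compl_comap (b := n - 1) (fun c => ?_) hl
      · omega
      · rcases Nat.lt_or_ge c 3 with hc | hc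
        -- The small classes also fit under `n - 1`, since `2 * k ≤ 2 * n - 1`.
        · interval_cases c <;> omega
        · rw [Finset.filter_false_of_mem fun i _ => ((hcls i).trans_le hc).ne]
          simp
    · rw [compl_compl] at h
      exact SimpleGraph.not_join_isContained_comap hcard
        (fun I hI => SimpleGraph.two_mul_card_le_of_injective_adj hτ hadj hI) hcls (by omega)
        (by omega) h
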